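/- Let $h\ge 1$, $c\ge 0$ and $q\ge 0$ be constants. In the Congested Clique model on $n\ge 2$ vertices, computation proceeds in synchronous rounds; in every round each vertex may send a (possibly different) message of $\lceil\log_2 n\rceil$ bits to every other vertex, and local computation is free. Let $\mathbb F$ be a finite field with at most $n^q$ elements, so that each element is represented by $O(\log n)$ bits. For $1\le k\le n$, let $\mathsf{MM}(n,n,k)$ be the least number of rounds in which a deterministic Congested Clique algorithm can compute the product $P=ST$ of an arbitrary $k\times n$ matrix $S$ and an arbitrary $n\times n$ matrix $T$ over $\mathbb F$, where the input of vertex $i\in[n]$ is $S[*,i]$ and $T[*,i]$, and vertex $i\in[k]$ has to output $P[i,*]$. For a directed graph $G$ with vertex set $[n]$, an $h$-cycle is a tuple $(v_1,\dots,v_h,v_1)$ with $v_1,\dots,v_h$ distinct, with edges from $v_i$ to $v_{i+1}$ for $1\le i<h$, and with an edge from $v_h$ to $v_1$. Let $x$ be the number of vertices of $G$ that participate in an $h$-cycle. (Undirected graphs are included as the symmetric directed graphs; for them one takes $h\ge 3$.) Theorem. There is a randomized Congested Clique algorithm for detecting an $h$-cycle (with private coins, in which each vertex initially knows its out-neighbours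 in $G$, and which does not know $x$) such that for every directed graph $G$ on $[n]$: 1. (One-sided error.) For every outcome of the random choices, all vertices halt with a common answer, and this answer is never "True" if $G$ has no $h$-cycle. 2. With probability at least $1-n^{-c}$, all vertices halt with the correct answer ("True" if $G$ has an $h$-cycle, "False" otherwise) within $$C\cdot\lceil \log_2 n\rceil^2\cdot \mathsf{MM}\left(n,n,\left\lceil \frac{n}{\max(x,1)}\right\rceil\right)=\tilde O\left(\mathsf{MM}\left(n,n,\left\lceil \frac{n}{\max(x,1)}\right\rceil\right)\right)$$ rounds, where the constant $C$ depends only on $h$, $c$ and $q$. -/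

import Mathlib

/-- The content of one message of the Congested Clique on `n` vertices: `⌈log₂ n⌉` bits. -/
abbrev CliqueMessage (n : ℕ) : Type := Fin (Nat.clog 2 n) → Bool

/-- A (deterministic) algorithm in the Congested Clique model on the vertices `0, …, n - 1`.
Every vertex knows its own name and its local input, and local computation is unrestricted.
`send s u` is the message that a vertex in state `s` sends to the vertex `u`, and `receive s m` is
the new state of a vertex in state `s` that receives the message `m u` from every vertex `u`.
A vertex has halted, with output `y`, as soon as `output` takes the value `some y` on its state. -/
structure CliqueAlgorithm (n : ℕ) (In Out : Type) where
  State : Type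
  init : Fin n → In → State
  send : State → Fin n → CliqueMessage n
  receive : State → (Fin n → CliqueMessage n) → State
  output : State → Option Out

namespace CliqueAlgorithm

variable {n : ℕ} {In Out : Type}

/-- The state of every vertex after `t` synchronous rounds, when vertex `v` has local input `x v`.
The state of a vertex that has halted does not change any more. -/
def stateAfter (A : CliqueAlgorithm n In Out) (x : Fin n → In) : ℕ → Fin n → A.State
  | 0, v => A.init v (x v)
  | t + 1, v =>
      if (A.output (A.stateAfter x t v)).isSome then A.stateAfter x t v
      else A.receive (A.stateAfter x t v) (fun u => A.send (A.stateAfter x t u) v)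

/-- On the input `x`, all vertices have halted after at most `T` rounds,
and the output of vertex `v` is `y v`. -/
def OutputsWithin (A : CliqueAlgorithm n In Out) (x : Fin n → In) (T : ℕ) (y : Fin n → Out) :
    Prop :=
  ∀ v, A.output (A.stateAfter x T v) = some (y v)

end CliqueAlgorithm

/-- `A` multiplies every `k × n` matrix `S` by every `n × n` matrix `M` over `F` (`k ≤ n`) in at
most `T` rounds. The input of vertex `i` consists of the `i`-th columns of `S` and of `M`; the
output of each of the first `k` vertices is its row of `S * M`, the output of the remaining
vertices being irrelevant. -/
def MultipliesWithin (F : Type) [Field F] (n k T : ℕ)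
    (A : CliqueAlgorithm n ((Fin k → F) × (Fin n → F)) (Fin n → F)) : Prop :=
  ∀ (S : Matrix (Fin k) (Fin n) F) (M : Matrix (Fin n) (Fin n) F),
    ∃ y : Fin n → Fin n → F,
      A.OutputsWithin (fun i => (fun r => S r i, fun r => M r i)) T y ∧
      ∀ (i : Fin n) (hi : i.val < k) (j : Fin n), y i j = (S * M) ⟨i.val, hi⟩ j

/-- The round complexity `MM(n, n, k)` (for `k ≤ n`) of rectangular matrix multiplication over `F`:
the least number of rounds in which an algorithm multiplies all `k × n` by `n × n` matrices. -/
noncomputable def mmRounds (F : Type) [Field F] (n k : ℕ) : ℕ∞ :=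
  ⨅ (T : ℕ) (_ : ∃ A, MultipliesWithin F n k T A), (T : ℕ∞)

/-- `(c 0, …, c (h - 1), c 0)` is an `h`-cycle: the `c i` are distinct and there is an edge from each
of them to the cyclically next one. -/
def Digraph.IsCycleTuple {V : Type} (G : Digraph V) (h : ℕ) (c : Fin h → V) : Prop :=
  Function.Injective c ∧ ∀ i, G.Adj (c i) (c (finRotate h i))

/-- `G` contains an `h`-cycle. -/
def Digraph.HasCycle {V : Type} (G : Digraph V) (h : ℕ) : Prop :=
  ∃ c : Fin h → V, G.IsCycleTuple h c

/-- The set of vertices that participate in an `h`-cycle of `G`. -/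
def Digraph.cycleVertices {V : Type} (G : Digraph V) (h : ℕ) : Set V :=
  {v | ∃ c : Fin h → V, G.IsCycleTuple h c ∧ v ∈ Set.range c}

/-- The probability of the event `P` under the uniform distribution on the finite type `Ω`. -/
noncomputable def uniformProb {Ω : Type} [Fintype Ω] (P : Ω → Prop) : ℝ :=
  (Nat.card {ω // P ω} : ℝ) / (Fintype.card Ω : ℝ)

/-- A randomized Congested Clique algorithm for graphs on `n` vertices with a yes/no answer: next to
its out-neighbourhood, each vertex gets a private random element of a nonempty finite set
`{0, …, coins - 1}`, uniformly distributed and independent of those of the other vertices. -/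
structure RandomizedGraphAlgorithm (n : ℕ) where
  coins : ℕ
  coins_pos : 0 < coins
  alg : CliqueAlgorithm n (Set (Fin n) × Fin coins) Bool

/-- On the graph `G` and with the random choices `r`, all vertices halt within `T` rounds,
and all of them output `b`. -/
def RandomizedGraphAlgorithm.AnswersWithin {n : ℕ} (A : RandomizedGraphAlgorithm n)
    (G : Digraph (Fin n)) (r : Fin n → Fin A.coins) (T : ℕ) (b : Bool) : Prop :=
  A.alg.OutputsWithin (fun v => ({u | G.Adj v u}, r v)) T (fun _ => b)

/-! The algorithm is colour coding from sampled start vertices. In a trial of width `k`, each of the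
first `k` vertices draws a start vertex and every vertex draws a colour in `0, …, h`, where `h`
means deleted. Multiplying a `k × n` matrix by the adjacency matrix `h` times yields, for each
start, the number in `F` of closed walks whose vertices have colours `0, …, h - 1` in order. Such a
walk has distinct vertices, so a nonzero count certifies an `h`-cycle
(`hasCycle_of_walkSum_ne_zero`); hence the error is one-sided.

Conversely, the count might vanish in `F` although cycles exist. But every colouring off a given
cycle extends over the cycle to one with nonzero count (`exists_colouring_walkSum_ne_zero`), so a
start on a cycle succeeds with probability at least `(h + 1)^(-h)`. If `n ≤ 2 * k * x`, some sampled
start lies on a cycle with probability at least `1/3`. Repeating the trial `3 * (h + 1)^h * c *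
⌈log₂ n⌉` times leaves failure probability at most `n^(-c)`.

Since `x` is unknown, the widths `1, 2, 4, … ≤ n` are tried in increasing order until an alarm
(`exists_detection_algorithm`). With `k = ⌈n / max x 1⌉`, the largest power of two below or equal to
`k` is wide enough if `x ≥ 1`, and no multiplication up to there costs more than `MM(n, n, k)`, by
monotonicity. This makes `O(log² n)` trials. Without a cycle, `k = n` and the complete search fits
the budget. -/

namespace CliqueAlgorithm

/-! ### Sequential composition of algorithms -/

variable {n : ℕ} {In In' Out : Type}

theorem stateAfter_succ (A : CliqueAlgorithm n In Out) (x : Fin n → In) (t : ℕ) (v : Fin n) :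
    A.stateAfter x (t + 1) v = if (A.output (A.stateAfter x t v)).isSome then A.stateAfter x t v
      else A.receive (A.stateAfter x t v) (fun u => A.send (A.stateAfter x t u) v) :=
  rfl

theorem stateAfter_eq_of_isSome (A : CliqueAlgorithm n In Out) (x : Fin n → In) {t s : ℕ}
    (hts : t ≤ s) {v : Fin n} (hv : (A.output (A.stateAfter x t v)).isSome) :
    A.stateAfter x s v = A.stateAfter x t v := by
  induction s, hts using Nat.le_induction with
  | base => rfl
  | succ s _ ih => rw [stateAfter, ih, if_pos hv]

theorem OutputsWithin.mono {A : CliqueAlgorithm n In Out} {x : Fin n → In} {t s : ℕ}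
    {y : Fin n → Out} (hA : A.OutputsWithin x t y) (hts : t ≤ s) : A.OutputsWithin x s y := by
  intro v
  rw [A.stateAfter_eq_of_isSome x hts (by rw [hA v]; rfl), hA v]

/-- On the input `x`, all vertices halt after exactly `T` rounds, vertex `v` with output `y v`. -/
def HaltsAt (A : CliqueAlgorithm n In Out) (x : Fin n → In) (T : ℕ) (y : Fin n → Out) : Prop :=
  (∀ t < T, ∀ v, A.output (A.stateAfter x t v) = none) ∧ A.OutputsWithin x T y

/-- The algorithm that first applies a local function to the inputs. -/
def comap (A : CliqueAlgorithm n In Out) (f : Fin n → In' → In) : CliqueAlgorithm n In' Out where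
  State := A.State
  init v x := A.init v (f v x)
  send := A.send
  receive := A.receive
  output := A.output

theorem stateAfter_comap (A : CliqueAlgorithm n In Out) (f : Fin n → In' → In) (x : Fin n → In')
    (t : ℕ) : (A.comap f).stateAfter x t = A.stateAfter (fun v => f v (x v)) t := by
  induction t with
  | zero => rfl
  | succ t ih =>
    funext v
    simp only [stateAfter, ih]
    rfl

theorem outputsWithin_comap (A : CliqueAlgorithm n In Out) (f : Fin n → In' → In)
    (x : Fin n → In') (t : ℕ) (y : Fin n → Out) :
    (A.comap f).OutputsWithin x t y ↔ A.OutputsWithin (fun v => f v (x v)) t y := by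
  simp only [OutputsWithin, stateAfter_comap]
  rfl

theorem haltsAt_comap (A : CliqueAlgorithm n In Out) (f : Fin n → In' → In)
    (x : Fin n → In') (t : ℕ) (y : Fin n → Out) :
    (A.comap f).HaltsAt x t y ↔ A.HaltsAt (fun v => f v (x v)) t y := by
  simp only [HaltsAt, outputsWithin_comap, stateAfter_comap]
  rfl

/-- The algorithm that halts at once with a locally computed output. -/
def halted (g : Fin n → In → Out) : CliqueAlgorithm n In Out where
  State := Out
  init := g
  send _ _ _ := false
  receive s _ := s
  output := some

theorem haltsAt_halted (g : Fin n → In → Out) (x : Fin n → In) :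
    (halted g).HaltsAt x 0 (fun v => g v (x v)) :=
  ⟨by simp, fun _ => rfl⟩

/-- The algorithm that performs one round of communication, and then continues with `A` on the
original inputs together with the received messages. -/
def prependRound (send : Fin n → In → Fin n → CliqueMessage n)
    (A : CliqueAlgorithm n (In × (Fin n → CliqueMessage n)) Out) : CliqueAlgorithm n In Out where
  State := (Fin n × In) ⊕ A.State
  init v x := Sum.inl (v, x)
  send s u := s.elim (fun p => send p.1 p.2 u) (fun s => A.send s u)
  receive s m := s.elim (fun p => Sum.inr (A.init p.1 (p.2, m))) (fun s => Sum.inr (A.receive s m))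
  output s := s.elim (fun _ => none) A.output

theorem stateAfter_prependRound (send : Fin n → In → Fin n → CliqueMessage n)
    (A : CliqueAlgorithm n (In × (Fin n → CliqueMessage n)) Out) (x : Fin n → In) (t : ℕ)
    (v : Fin n) : (A.prependRound send).stateAfter x (t + 1) v =
      Sum.inr (A.stateAfter (fun v => (x v, fun u => send u (x u) v)) t v) := by
  induction t generalizing v with
  | zero => rfl
  | succ t ih =>
    rw [stateAfter_succ _ x (t + 1), stateAfter_succ A]
    simp only [ih]
    change (if (A.output _).isSome = true then _ else _) = _
    split_ifs with hv
    exacts [if_pos hv, if_neg hv]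

theorem haltsAt_prependRound (send : Fin n → In → Fin n → CliqueMessage n)
    (A : CliqueAlgorithm n (In × (Fin n → CliqueMessage n)) Out) (x : Fin n → In) (t : ℕ)
    (y : Fin n → Out) (hA : A.HaltsAt (fun v => (x v, fun u => send u (x u) v)) t y) :
    (A.prependRound send).HaltsAt x (t + 1) y := by
  refine ⟨fun s hs v => ?_, fun v => ?_⟩
  · cases s with
    | zero => rfl
    | succ s =>
      rw [stateAfter_prependRound]
      exact hA.1 s (by omega) v
  · rw [stateAfter_prependRound]
    exact hA.2 v

open Classical in
/-- The algorithm in which every vertex first tells all vertices whether its input satisfies `p`.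
If this is the case for some vertex, then all vertices halt with output `b`, else they continue
with `A`. -/
noncomputable def prependVote (p : Fin n → In → Prop) (b : Out) (A : CliqueAlgorithm n In Out) :
    CliqueAlgorithm n In Out where
  State := (Fin n × In) ⊕ Out ⊕ A.State
  init v x := Sum.inl (v, x)
  send s u := s.elim (fun a _ => decide (p a.1 a.2))
    (fun s => s.elim (fun _ _ => false) (fun s => A.send s u))
  receive s m := s.elim
    (fun a => if ∃ u i, m u i = true then Sum.inr (Sum.inl b) else Sum.inr (Sum.inr (A.init a.1 a.2)))
    (fun s => s.elim (fun y => Sum.inr (Sum.inl y)) (fun s => Sum.inr (Sum.inr (A.receive s m))))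
  output s := s.elim (fun _ => none) (fun s => s.elim some A.output)

open Classical in
theorem stateAfter_prependVote_one (hn : 2 ≤ n) (p : Fin n → In → Prop) (b : Out)
    (A : CliqueAlgorithm n In Out) (x : Fin n → In) (hp : ∃ v, p v (x v)) (v : Fin n) :
    (A.prependVote p b).stateAfter x 1 v = Sum.inr (Sum.inl b) := by
  obtain ⟨u, hu⟩ := hp
  -- An alarm needs at least one bit per message, which is where `2 ≤ n` enters.
  have : 0 < Nat.clog 2 n := Nat.clog_pos (by omega) hn
  have h : ∃ u, ∃ _ : Fin (Nat.clog 2 n), decide (p u (x u)) = true :=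
    ⟨u, ⟨0, this⟩, decide_eq_true hu⟩
  exact if_pos h

open Classical in
theorem stateAfter_prependVote_succ (p : Fin n → In → Prop) (b : Out)
    (A : CliqueAlgorithm n In Out) (x : Fin n → In) (hp : ¬ ∃ v, p v (x v)) (t : ℕ) (v : Fin n) :
    (A.prependVote p b).stateAfter x (t + 1) v = Sum.inr (Sum.inr (A.stateAfter x t v)) := by
  induction t generalizing v with
  | zero =>
    have h : ¬ ∃ u, ∃ _ : Fin (Nat.clog 2 n), decide (p u (x u)) = true := by
      rintro ⟨u, i, hu⟩
      exact hp ⟨u, of_decide_eq_true hu⟩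
    exact if_neg h
  | succ t ih =>
    rw [stateAfter_succ _ x (t + 1), stateAfter_succ A]
    simp only [ih]
    change (if (A.output _).isSome = true then _ else _) = _
    split_ifs with hv
    exacts [if_pos hv, if_neg hv]

theorem haltsAt_prependVote_of_exists (hn : 2 ≤ n) (p : Fin n → In → Prop) (b : Out)
    (A : CliqueAlgorithm n In Out) (x : Fin n → In) (hp : ∃ v, p v (x v)) :
    (A.prependVote p b).HaltsAt x 1 (fun _ => b) := by
  refine ⟨fun s hs v => ?_, fun v => ?_⟩
  · obtain rfl : s = 0 := by omega
    rfl
  · rw [stateAfter_prependVote_one hn p b A x hp]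
    rfl

theorem haltsAt_prependVote_of_not_exists (p : Fin n → In → Prop) (b : Out)
    (A : CliqueAlgorithm n In Out) (x : Fin n → In) (hp : ¬ ∃ v, p v (x v)) {t : ℕ}
    {y : Fin n → Out} (hA : A.HaltsAt x t y) : (A.prependVote p b).HaltsAt x (t + 1) y := by
  refine ⟨fun s hs v => ?_, fun v => ?_⟩
  · cases s with
    | zero => rfl
    | succ s =>
      rw [stateAfter_prependVote_succ p b A x hp]
      exact hA.1 s (by omega) v
  · rw [stateAfter_prependVote_succ p b A x hp]
    exact hA.2 v

end CliqueAlgorithm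

/-! ### Round-by-round computability, freed from explicit state machines -/

/-- The vertices of a Congested Clique can compute `f` in `t` rounds: if vertex `v` knows `x v` for
every `v`, then after `t` rounds of communication, vertex `v` can know `f x v` for every `v`. -/
def RoundComputable {n : ℕ} {τ : Type} :
    ℕ → {σ : Type} → ((Fin n → σ) → Fin n → τ) → Prop
  | 0, σ, f => ∃ g : Fin n → σ → τ, ∀ x v, f x v = g v (x v)
  | t + 1, σ, f => ∃ (send : Fin n → σ → Fin n → CliqueMessage n)
      (f' : (Fin n → σ × (Fin n → CliqueMessage n)) → Fin n → τ),
      RoundComputable t f' ∧ ∀ x, f x = f' (fun v => (x v, fun u => send u (x u) v))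

namespace RoundComputable

variable {n : ℕ} {σ τ υ : Type}

theorem of_local (g : Fin n → σ → τ) :
    RoundComputable 0 (fun (x : Fin n → σ) v => g v (x v)) :=
  ⟨g, fun _ _ => rfl⟩

theorem comp_local {t : ℕ} {f : (Fin n → τ) → Fin n → υ} (hf : RoundComputable t f)
    (g : Fin n → σ → τ) : RoundComputable t (fun x => f (fun v => g v (x v))) := by
  induction t generalizing σ τ with
  | zero =>
    obtain ⟨k, hk⟩ := hf
    exact ⟨fun v a => k v (g v a), fun x v => hk _ v⟩
  | succ t ih =>
    obtain ⟨send, f', hf', hff⟩ := hf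
    exact ⟨fun v a => send v (g v a), _, ih hf' (fun v a => (g v a.1, a.2)), fun x => hff _⟩

theorem comp {s t : ℕ} {f : (Fin n → σ) → Fin n → τ} {g : (Fin n → τ) → Fin n → υ}
    (hg : RoundComputable t g) (hf : RoundComputable s f) :
    RoundComputable (s + t) (fun x => g (f x)) := by
  induction s generalizing σ with
  | zero =>
    obtain ⟨k, hk⟩ := hf
    have : f = fun x v => k v (x v) := by
      funext x v
      exact hk x v
    rw [this, Nat.zero_add]
    exact hg.comp_local k
  | succ s ih =>
    obtain ⟨send, f', hf', hff⟩ := hf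
    rw [Nat.add_right_comm]
    exact ⟨send, _, ih hf', fun x => by simp only [hff]⟩

theorem map {t : ℕ} {f : (Fin n → σ) → Fin n → τ} (hf : RoundComputable t f)
    (g : Fin n → τ → υ) : RoundComputable t (fun x v => g v (f x v)) :=
  (of_local g).comp hf

theorem with_input {t : ℕ} {f : (Fin n → σ) → Fin n → τ} (hf : RoundComputable t f) :
    RoundComputable t (fun x v => (x v, f x v)) := by
  induction t generalizing σ with
  | zero =>
    obtain ⟨k, hk⟩ := hf
    exact ⟨fun v a => (a, k v a), fun x v => by simp only [hk]⟩
  | succ t ih =>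
    obtain ⟨send, f', hf', hff⟩ := hf
    exact ⟨send, _, (ih hf').map (fun _ a => (a.1.1, a.2)), fun x => by simp only [hff]⟩

/-- The two computations run one after the other, the inputs being remembered meanwhile. -/
theorem prod {s t : ℕ} {f : (Fin n → σ) → Fin n → τ} {g : (Fin n → σ) → Fin n → υ}
    (hf : RoundComputable s f) (hg : RoundComputable t g) :
    RoundComputable (s + t) (fun x v => (f x v, g x v)) :=
  (((hg.comp_local (fun _ (a : σ × τ) => a.1)).with_input).comp hf.with_input).map
    (fun _ a => (a.1.2, a.2))

theorem round (send : Fin n → σ → Fin n → CliqueMessage n) :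
    RoundComputable 1 (fun x v u => send u (x u) v) :=
  ⟨send, _, of_local (fun _ a => a.2), fun _ => rfl⟩

theorem exchange_tuple (R : ℕ) (p : Fin n → σ → Fin n → Fin R → CliqueMessage n) :
    RoundComputable R (fun x v u => p u (x u) v) := by
  induction R with
  | zero => exact ⟨fun _ _ _ => Fin.elim0, fun x v => funext fun u => Subsingleton.elim _ _⟩
  | succ R ih =>
    have h := ((ih (fun v a u i => p v a u i.castSucc)).prod
      (round (fun v a u => p v a u (Fin.last R)))).map
      (fun _ a u => (Fin.snoc (a.1 u) (a.2 u) : Fin (R + 1) → CliqueMessage n))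
    convert h using 4 with x v u
    exact (Fin.snoc_init_self _).symm

/-- Every vertex sends to every vertex an element of a type `α` that is small enough to be encoded
by `R` messages. -/
theorem exchange {α : Type} [Fintype α] [Nonempty α] {R : ℕ} (hα : Fintype.card α ≤ n ^ R)
    (p : Fin n → σ → Fin n → α) : RoundComputable R (fun x v u => p u (x u) v) := by
  have hc : Fintype.card α ≤ Fintype.card (Fin R → CliqueMessage n) := by
    simp only [Fintype.card_fun, Fintype.card_fin, Fintype.card_bool]
    exact hα.trans (Nat.pow_le_pow_left (Nat.le_pow_clog (by omega) n) R)
  obtain ⟨e⟩ := Function.Embedding.nonempty_of_card_le hc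
  have h := (exchange_tuple R (fun v (a : σ) u => e (p v a u))).map
    (fun _ a u => Function.invFun e (a u))
  convert h using 4 with x v u
  exact (Function.leftInverse_invFun e.injective _).symm

/-- A Congested Clique algorithm can be run for `t` rounds. -/
theorem stateAfter {In Out : Type} (A : CliqueAlgorithm n In Out) (t : ℕ) :
    RoundComputable t (fun x v => A.stateAfter x t v) := by
  induction t with
  | zero => exact of_local A.init
  | succ t ih =>
    have h := (((round (fun _ (s : A.State) u => A.send s u)).with_input).map
      (fun _ a => if (A.output a.1).isSome then a.1 else A.receive a.1 a.2)).comp ih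
    exact h

/-- The bridge back to genuine algorithms: each round of `f` becomes a `prependRound`, and the
remaining running time may still depend on the input. -/
theorem prepend {In Out : Type} {t : ℕ} {f : (Fin n → In) → Fin n → σ}
    (hf : RoundComputable t f) (A : CliqueAlgorithm n σ Out) :
    ∃ A' : CliqueAlgorithm n In Out, ∀ x s y, A.HaltsAt (f x) s y → A'.HaltsAt x (t + s) y := by
  induction t generalizing In with
  | zero =>
    obtain ⟨g, hg⟩ := hf
    refine ⟨A.comap g, fun x s y h => ?_⟩
    rw [CliqueAlgorithm.haltsAt_comap, Nat.zero_add]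
    convert h using 1
    funext v
    exact (hg x v).symm
  | succ t ih =>
    obtain ⟨send, f', hf', hff⟩ := hf
    obtain ⟨A', hA'⟩ := ih hf'
    refine ⟨A'.prependRound send, fun x s y h => ?_⟩
    rw [Nat.add_right_comm]
    exact A'.haltsAt_prependRound send x _ y (hA' _ _ _ (by rw [← hff]; exact h))

theorem exists_algorithm {t : ℕ} {f : (Fin n → σ) → Fin n → τ} (hf : RoundComputable t f) :
    ∃ A : CliqueAlgorithm n σ τ, ∀ x, A.HaltsAt x t (f x) := by
  obtain ⟨A, hA⟩ := hf.prepend (CliqueAlgorithm.halted fun _ a => a)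
  exact ⟨A, fun x => hA x 0 _ (CliqueAlgorithm.haltsAt_halted _ _)⟩

open Classical in
/-- A family of tests that are performed one after the other, until the first one in which some
vertex raises an alarm. -/
theorem exists_search {ι : Type} (hn : 2 ≤ n) (t : ι → ℕ) (b : ι → (Fin n → σ) → Fin n → Prop)
    (l : List ι) (hb : ∀ i ∈ l, RoundComputable (t i) (b i)) :
    ∃ A : CliqueAlgorithm n σ Bool, ∀ x, ∃ T ans, A.HaltsAt x T (fun _ => ans) ∧
      (ans = true → ∃ i ∈ l, ∃ v, b i x v) ∧ T ≤ (l.map fun i => t i + 1).sum ∧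
      ∀ l₁ l₂, l = l₁ ++ l₂ → (∃ i ∈ l₁, ∃ v, b i x v) →
        ans = true ∧ T ≤ (l₁.map fun i => t i + 1).sum := by
  induction l with
  | nil =>
    refine ⟨CliqueAlgorithm.halted fun _ _ => false, fun x => ⟨0, false,
      CliqueAlgorithm.haltsAt_halted _ _, by simp, by simp, ?_⟩⟩
    rintro l₁ l₂ h ⟨i, hi, -⟩
    simp_all
  | cons i l ih =>
    obtain ⟨A, hA⟩ := ih fun j hj => hb j (List.mem_cons_of_mem _ hj)
    obtain ⟨A', hA'⟩ := ((hb i List.mem_cons_self).with_input).prepend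
      ((A.comap fun _ (a : σ × Prop) => a.1).prependVote (fun _ a => a.2) true)
    refine ⟨A', fun x => ?_⟩
    by_cases hx : ∃ v, b i x v
    · refine ⟨t i + 1, true, hA' _ _ _
        (CliqueAlgorithm.haltsAt_prependVote_of_exists hn (fun _ a => a.2) true _
          (fun v => (x v, b i x v)) hx),
        fun _ => ⟨i, List.mem_cons_self, hx⟩, by simp, ?_⟩
      rintro (_ | ⟨j, l₁⟩) l₂ h ⟨k, hk, -⟩
      · simp at hk
      · obtain ⟨rfl, -⟩ : i = j ∧ _ := List.cons.inj h
        simp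
    -- No alarm in the first test: it costs its rounds plus one for the vote, and the search goes on
    -- with the original inputs.
    · obtain ⟨T, ans, h1, h2, h3, h4⟩ := hA x
      refine ⟨t i + (T + 1), ans, hA' _ _ _
        (CliqueAlgorithm.haltsAt_prependVote_of_not_exists (fun _ a => a.2) true _
          (fun v => (x v, b i x v)) hx ((A.haltsAt_comap _ _ _ _).2 h1)), fun h => ?_, ?_, ?_⟩
      · obtain ⟨j, hj, hv⟩ := h2 h
        exact ⟨j, List.mem_cons_of_mem _ hj, hv⟩
      · simp only [List.map_cons, List.sum_cons]
        omega
      · rintro (_ | ⟨j, l₁⟩) l₂ h ⟨k, hk, hv⟩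
        · simp at hk
        · obtain ⟨rfl, h'⟩ : i = j ∧ _ := List.cons.inj h
          rcases List.mem_cons.1 hk with rfl | hk
          · exact absurd hv hx
          · obtain ⟨h5, h6⟩ := h4 l₁ l₂ h' ⟨k, hk, hv⟩
            refine ⟨h5, ?_⟩
            simp only [List.map_cons, List.sum_cons]
            omega

end RoundComputable

/-! ### Colourful walks and colour coding over an arbitrary field -/

open Classical in
/-- The number (in `F`) of walks with `j` edges from `s` to a given vertex, in which the vertices
before the last one have the colours `0, …, j - 1`, in this order. -/
noncomputable def walkSum {V F : Type} [Fintype V] [Field F] (A : Matrix V V F) (col : V → ℕ)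
    (s : V) : ℕ → V → F
  | 0, v => if s = v then 1 else 0
  | j + 1, v => ∑ u, (if col u = j then walkSum A col s j u else 0) * A u v

open Classical in
/-- The adjacency matrix of a directed graph. -/
noncomputable def Digraph.adjacency {V : Type} (G : Digraph V) (F : Type) [Field F] :
    Matrix V V F :=
  fun u v => if G.Adj u v then 1 else 0

/-- Starting a cycle at one of its vertices. -/
theorem Digraph.IsCycleTuple.exists_closed_walk {V : Type} {G : Digraph V} {h : ℕ} {c : Fin h → V}
    (hc : G.IsCycleTuple h c) (i₀ : Fin h) :
    ∃ d : ℕ → V, d 0 = c i₀ ∧ d h = c i₀ ∧ (∀ i, G.Adj (d i) (d (i + 1))) ∧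
      (∀ i, d i ∈ Set.range c) ∧ ∀ i < h, ∀ j < h, d i = d j → i = j := by
  rcases h with _ | m
  · exact i₀.elim0
  refine ⟨fun i => c (i₀ + Fin.ofNat (m + 1) i), by simp, by simp, fun i => ?_, fun i => ⟨_, rfl⟩,
    fun i hi j hj hij => ?_⟩
  · have h1 := hc.2 (i₀ + Fin.ofNat (m + 1) i)
    have h2 : Fin.ofNat (m + 1) (i + 1) = Fin.ofNat (m + 1) i + 1 := by
      ext
      simp [Fin.val_add]
    rw [finRotate_apply, add_assoc, ← h2] at h1
    exact h1
  · have h1 := congrArg Fin.val (add_left_cancel (hc.1 hij))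
    rwa [Fin.val_ofNat, Fin.val_ofNat, Nat.mod_eq_of_lt hi, Nat.mod_eq_of_lt hj] at h1

section Walks

variable {V F : Type} [Fintype V] [Field F]

open Classical in
theorem walkSum_zero (A : Matrix V V F) (col : V → ℕ) (s v : V) :
    walkSum A col s 0 v = if s = v then 1 else 0 :=
  rfl

open Classical in
theorem walkSum_succ (A : Matrix V V F) (col : V → ℕ) (s : V) (j : ℕ) (v : V) :
    walkSum A col s (j + 1) v = ∑ u, (if col u = j then walkSum A col s j u else 0) * A u v :=
  rfl

/-- Only the colour classes below `j` enter a sum over `j` edges; the end vertex is not tested. -/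
theorem walkSum_congr (A : Matrix V V F) {col col' : V → ℕ} (s : V) (j : ℕ)
    (hc : ∀ i < j, ∀ v, col v = i ↔ col' v = i) : walkSum A col s j = walkSum A col' s j := by
  induction j with
  | zero => rfl
  | succ j ih =>
    funext v
    simp only [walkSum, ih fun i hi => hc i (by omega), hc j (by omega)]

theorem exists_walk_of_walkSum_ne_zero (G : Digraph V) (col : V → ℕ) (s : V) (j : ℕ) (v : V)
    (hv : walkSum (G.adjacency F) col s j v ≠ 0) :
    ∃ w : ℕ → V, w 0 = s ∧ w j = v ∧ ∀ i < j, col (w i) = i ∧ G.Adj (w i) (w (i + 1)) := by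
  induction j generalizing v with
  | zero =>
    refine ⟨fun _ => s, rfl, ?_, by simp⟩
    by_contra h
    exact hv (if_neg h)
  | succ j ih =>
    obtain ⟨u, -, hu⟩ := Finset.exists_ne_zero_of_sum_ne_zero hv
    have h1 : col u = j := by
      by_contra h
      simp [h] at hu
    have h2 : G.Adj u v := by
      by_contra h
      simp [Digraph.adjacency, h] at hu
    rw [if_pos h1] at hu
    obtain ⟨w, hw0, hwj, hw⟩ := ih u (left_ne_zero_of_mul hu)
    refine ⟨fun i => if i ≤ j then w i else v, by simpa using hw0, by simp, fun i hi => ?_⟩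
    rcases Nat.lt_succ_iff_lt_or_eq.1 hi with hi | rfl
    · have := hw i hi
      simpa [hi.le, Nat.succ_le_of_lt hi] using this
    · simp [hwj, h1, h2]

/-- A nonzero sum has a nonzero term, and the `i`-th vertex of that closed walk has colour `i`, so
the vertices are distinct. -/
theorem hasCycle_of_walkSum_ne_zero (G : Digraph V) (col : V → ℕ) (s : V) {h : ℕ}
    (hs : walkSum (G.adjacency F) col s h s ≠ 0) : G.HasCycle h := by
  obtain ⟨w, hw0, hwh, hw⟩ := exists_walk_of_walkSum_ne_zero G col s h s hs
  refine ⟨fun i => w i, fun i j hij => ?_, fun i => ?_⟩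
  · have h1 := congrArg col hij
    simp only [(hw i i.2).1, (hw j j.2).1] at h1
    exact Fin.ext h1
  · have h1 := (hw i i.2).2
    rcases h with _ | h
    · exact i.elim0
    · rcases eq_or_ne i (Fin.last h) with rfl | hi
      · simp only [finRotate_last, Fin.val_zero, hw0]
        simpa [hwh] using h1
      · have h2 : ((finRotate (h + 1) i : Fin (h + 1)) : ℕ) = i + 1 :=
          coe_finRotate_of_ne_last hi
        simpa only [h2] using h1

/-- Every colouring of the vertices outside a cycle extends to a colouring for which the number of
colourful cycles through a given vertex of the cycle does not vanish in `F`. The colour `h` is used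
for deleted vertices. -/
theorem exists_colouring_walkSum_ne_zero {G : Digraph V} {h : ℕ} {c : Fin h → V}
    (hc : G.IsCycleTuple h c) (i₀ : Fin h) (col₀ : V → Fin (h + 1)) :
    ∃ col : V → Fin (h + 1), (∀ v ∉ Set.range c, col v = col₀ v) ∧
      walkSum (G.adjacency F) (fun v => col v) (c i₀) h (c i₀) ≠ 0 := by
  classical
  obtain ⟨d, hd0, hdh, hdadj, hdc, hdinj⟩ := hc.exists_closed_walk i₀
  -- Start with the whole cycle deleted and decide on `d 0, d 1, …` in turn; after `j` steps, `d j,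
  -- …, d (h - 1)` are still deleted.
  have key : ∀ j ≤ h, ∃ col : V → Fin (h + 1), (∀ v ∉ Set.range c, col v = col₀ v) ∧
      (∀ i, j ≤ i → i < h → (col (d i) : ℕ) = h) ∧
      walkSum (G.adjacency F) (fun v => col v) (c i₀) j (d j) ≠ 0 := by
    intro j
    induction j with
    | zero =>
      refine fun _ => ⟨fun v => if v ∈ Set.range c then Fin.last h else col₀ v, fun v hv => ?_,
        fun i _ _ => ?_, ?_⟩
      · exact if_neg hv
      · simp only [if_pos (hdc i), Fin.val_last]
      · simp [walkSum, hd0]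
    | succ j ih =>
      intro hj
      obtain ⟨col, h1, h2, h3⟩ := ih (by omega)
      let col' := Function.update col (d j) ⟨j, by omega⟩
      -- If the next sum is already nonzero, `d j` stays deleted. If it vanishes, giving `d j` the
      -- colour `j` adds exactly the previous, nonzero sum at `d j`.
      by_cases h0 : walkSum (G.adjacency F) (fun v => col v) (c i₀) (j + 1) (d (j + 1)) = 0
      · refine ⟨col', fun v hv => ?_, fun i hi hih => ?_, ?_⟩
        · have : v ≠ d j := by
            rintro rfl
            exact hv (hdc j)
          simp only [col', Function.update_of_ne this, h1 v hv]
        · have : d i ≠ d j := fun e => by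
            have := hdinj i hih j (by omega) e
            omega
          simp only [col', Function.update_of_ne this]
          exact h2 i (by omega) hih
        -- Neither the old colour `h` nor the new colour `j` of `d j` is below `j`.
        · have hcongr : walkSum (G.adjacency F) (fun v => col' v) (c i₀) j
              = walkSum (G.adjacency F) (fun v => col v) (c i₀) j := by
            refine walkSum_congr _ _ _ fun i hi v => ?_
            rcases eq_or_ne v (d j) with rfl | hv
            · have := h2 j le_rfl (by omega)
              simp only [col', Function.update_self]
              omega
            · simp only [col', Function.update_of_ne hv]
          have hdiff : walkSum (G.adjacency F) (fun v => col' v) (c i₀) (j + 1) (d (j + 1))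
              = walkSum (G.adjacency F) (fun v => col v) (c i₀) (j + 1) (d (j + 1))
                + walkSum (G.adjacency F) (fun v => col v) (c i₀) j (d j) := by
            simp only [walkSum, hcongr]
            rw [← Finset.add_sum_erase _ _ (Finset.mem_univ (d j)),
              ← Finset.add_sum_erase (a := d j) _ (fun u => (if (col u : ℕ) = j then _ else _) * _)
                (Finset.mem_univ (d j))]
            have e1 : (col' (d j) : ℕ) = j := by simp [col']
            have e2 : (col (d j) : ℕ) ≠ j := by
              rw [h2 j le_rfl (by omega)]
              omega
            have e3 : G.adjacency F (d j) (d (j + 1)) = 1 := if_pos (hdadj j)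
            rw [if_pos e1, if_neg e2, e3, zero_mul, zero_add, mul_one, add_comm]
            congr 1
            refine Finset.sum_congr rfl fun u hu => ?_
            simp only [col', Function.update_of_ne (Finset.ne_of_mem_erase hu)]
          rw [hdiff, h0, zero_add]
          exact h3
      · exact ⟨col, h1, fun i hi => h2 i (by omega), h0⟩
  obtain ⟨col, h1, -, h3⟩ := key h le_rfl
  exact ⟨col, h1, by rwa [hdh] at h3⟩

/-- A positive fraction of all colourings is successful. -/
theorem card_colourings_le {G : Digraph V} {h : ℕ} {c : Fin h → V}
    (hc : G.IsCycleTuple h c) (i₀ : Fin h) :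
    Nat.card (V → Fin (h + 1)) ≤ Nat.card {col : V → Fin (h + 1) //
      walkSum (G.adjacency F) (fun v => col v) (c i₀) h (c i₀) ≠ 0} * (h + 1) ^ h := by
  have h1 : Nat.card (Fin h → Fin (h + 1)) = (h + 1) ^ h := by simp
  rw [← h1, ← Nat.card_prod]
  -- Overwriting a successful colouring on the cycle by arbitrary values reaches every colouring, by
  -- the extension lemma.
  refine Nat.card_le_card_of_surjective (fun p => Function.extend c p.2 p.1.1) fun col₀ => ?_
  obtain ⟨col, h2, h3⟩ := exists_colouring_walkSum_ne_zero (F := F) hc i₀ col₀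
  refine ⟨(⟨col, h3⟩, fun i => col₀ (c i)), funext fun v => ?_⟩
  by_cases hv : v ∈ Set.range c
  · obtain ⟨i, rfl⟩ := hv
    exact hc.1.extend_apply _ _ i
  · change Function.extend c _ col v = _
    rw [Function.extend_apply' _ _ _ hv, h2 v hv]

end Walks

/-! ### Trials by matrix multiplication, and the search over widths -/

section Multiplication

variable {F : Type} [Field F] {n k T q h : ℕ}

theorem roundComputable_mul_rows
    {A : CliqueAlgorithm n ((Fin k → F) × (Fin n → F)) (Fin n → F)}
    (hA : MultipliesWithin F n k T A) :
    RoundComputable T (fun (x : Fin n → (Fin k → F) × (Fin n → F)) (v j : Fin n) =>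
      if hv : v.val < k then ∑ u, (x u).1 ⟨v, hv⟩ * (x j).2 u else 0) := by
  -- The default of `getD` is never used, as all vertices have halted after `T` rounds; rows from
  -- `k` on are set to zero.
  have h := (RoundComputable.stateAfter A T).map fun v s j =>
    if v.val < k then (A.output s).getD 0 j else 0
  convert h using 4 with x v j
  obtain ⟨y, hy, hmul⟩ := hA (fun r i => (x i).1 r) (fun r i => (x i).2 r)
  split_ifs with hv
  · have h1 := hy v
    simp only [Prod.mk.eta] at h1
    rw [h1, Option.getD_some, hmul v hv]
    rfl
  · rfl

/-- Products come out by rows but go in by columns. Each entry fits into `q` messages, so `q`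
further rounds transpose the result and allow iteration. -/
theorem roundComputable_mul_columns [Fintype F] (hF : Fintype.card F ≤ n ^ q) (hk : k ≤ n)
    {A : CliqueAlgorithm n ((Fin k → F) × (Fin n → F)) (Fin n → F)}
    (hA : MultipliesWithin F n k T A) :
    RoundComputable (T + q) (fun (x : Fin n → (Fin k → F) × (Fin n → F)) (v : Fin n) (r : Fin k) =>
      ∑ u, (x u).1 r * (x v).2 u) := by
  have h := ((RoundComputable.exchange hF
    (fun _ (y : Fin n → F) j => y j)).comp (roundComputable_mul_rows hA)).map
      fun v y (r : Fin k) => y (r.castLE hk)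
  convert h using 4 with x v r
  simp

/-- `walkSum` from `k` start vertices, when every vertex knows its column of the matrix, its colour,
and the start vertex that it has chosen. -/
theorem roundComputable_walkSum [Fintype F] (hn : 2 ≤ n) (hF : Fintype.card F ≤ n ^ q) (hk : k ≤ n)
    {A : CliqueAlgorithm n ((Fin k → F) × (Fin n → F)) (Fin n → F)}
    (hA : MultipliesWithin F n k T A) (j : ℕ) :
    RoundComputable (1 + j * (T + q))
      (fun (x : Fin n → (Fin n → F) × Fin n × Fin (h + 1)) (v : Fin n) (r : Fin k) =>
        walkSum (fun u w => (x w).1 u) (fun u => (x u).2.2) (x (r.castLE hk)).2.1 j v) := by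
  classical
  induction j with
  | zero =>
    -- One round tells each vertex who has chosen it, which is its column of the initial 0/1 matrix.
    have h := (RoundComputable.exchange (n := n) (α := Prop) (R := 1) (by simpa using hn)
      (fun _ (a : (Fin n → F) × Fin n × Fin (h + 1)) v => a.2.1 = v)).map
        fun v y (r : Fin k) => if y (r.castLE hk) then (1 : F) else 0
    rw [Nat.zero_mul]
    convert h using 4 with x v r
    refine (walkSum_zero _ _ _ _).trans ?_
    congr
  | succ j ih =>
    -- Masking by colour is local, since each vertex holds its own column.
    have h := (roundComputable_mul_columns hF hk hA).comp (ih.with_input.map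
      fun v a => ((fun r => if (a.1.2.2 : ℕ) = j then a.2 r else 0), a.1.1))
    rw [Nat.succ_mul, ← Nat.add_assoc]
    convert h using 4 with x v r
    refine (walkSum_succ _ _ _ _ _).trans (Finset.sum_congr rfl fun u _ => ?_)
    congr

/-- Every vertex can find out whether it is the start vertex of a closed colourful walk that has
been chosen by one of the first `k` vertices. -/
theorem roundComputable_closed_walk [Fintype F] (hn : 2 ≤ n) (hF : Fintype.card F ≤ n ^ q)
    (hk : k ≤ n) {A : CliqueAlgorithm n ((Fin k → F) × (Fin n → F)) (Fin n → F)}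
    (hA : MultipliesWithin F n k T A) :
    RoundComputable (2 + h * (T + q))
      (fun (x : Fin n → (Fin n → F) × Fin n × Fin (h + 1)) (v : Fin n) =>
        ∃ r : Fin n, r.val < k ∧ (x r).2.1 = v ∧
          walkSum (fun u w => (x w).1 u) (fun u => (x u).2.2) (x r).2.1 h v ≠ 0) := by
  have h := ((RoundComputable.exchange (n := n) (α := Prop) (R := 1) (by simpa using hn)
      (fun _ (a : (Fin n → F) × Fin n × Fin (h + 1)) v => a.2.1 = v)).prod
    (roundComputable_walkSum hn hF hk hA h)).map
      fun _ y => ∃ r : Fin k, y.1 (r.castLE hk) ∧ y.2 r ≠ 0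
  convert h using 1
  · ring
  · funext x v
    refine propext ⟨?_, ?_⟩
    · rintro ⟨r, hr, h1, h2⟩
      exact ⟨⟨r, hr⟩, h1, h2⟩
    · rintro ⟨r, h1, h2⟩
      exact ⟨r.castLE hk, r.2, h1, h2⟩

/-- Everybody sends the whole input to everybody, `N` possible inputs fitting into `N` messages. So
an optimal round number exists. -/
theorem exists_multipliesWithin (F : Type) [Field F] [Fintype F] (hn : 2 ≤ n) (k : ℕ) :
    ∃ T A, MultipliesWithin F n k T A := by
  have h := (RoundComputable.exchange (n := n) (α := (Fin k → F) × (Fin n → F))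
    (Nat.lt_pow_self hn).le
    (fun _ (a : (Fin k → F) × (Fin n → F)) _ => a)).map
      fun v y j => if hv : v.val < k then ∑ u, (y u).1 ⟨v, hv⟩ * (y j).2 u else 0
  obtain ⟨A, hA⟩ := h.exists_algorithm
  refine ⟨_, A, fun S M => ⟨_, (hA _).2, fun i hi j => ?_⟩⟩
  rw [dif_pos hi]
  rfl

/-- Pad `S` with zero rows. This gives monotonicity of the complexity in `k`. -/
theorem MultipliesWithin.exists_of_le {k' : ℕ} (hk : k ≤ k')
    {A : CliqueAlgorithm n ((Fin k' → F) × (Fin n → F)) (Fin n → F)}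
    (hA : MultipliesWithin F n k' T A) : ∃ A', MultipliesWithin F n k T A' := by
  refine ⟨A.comap fun _ a => (fun r => if hr : r.val < k then a.1 ⟨r, hr⟩ else 0, a.2),
    fun S M => ?_⟩
  obtain ⟨y, hy, hmul⟩ := hA (Matrix.of fun r i => if hr : r.val < k then S ⟨r, hr⟩ i else 0) M
  refine ⟨y, (A.outputsWithin_comap _ _ _ _).2 hy, fun i hi j => ?_⟩
  rw [hmul i (hi.trans_le hk) j]
  simp [Matrix.mul_apply, hi]

/-- An optimal multiplication algorithm. -/
theorem exists_optimal_multipliesWithin (F : Type) [Field F] [Fintype F] (hn : 2 ≤ n) (k : ℕ) :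
    ∃ T A, MultipliesWithin F n k T A ∧
      ∀ k' T' A', k ≤ k' → MultipliesWithin F n k' T' A' → T ≤ T' := by
  classical
  have h := exists_multipliesWithin F hn k
  obtain ⟨A, hA⟩ := Nat.find_spec h
  exact ⟨Nat.find h, A, hA, fun k' T' A' hk hA' => Nat.find_min' h (hA'.exists_of_le hk)⟩

/-- Without communication, vertex `0` cannot know the entry `M 0 1`, which a suitable `S` makes part
of its output. The bound lets additive constants be absorbed into multiples of `T`. -/
theorem MultipliesWithin.one_le (hn : 2 ≤ n) (hk : 1 ≤ k)
    {A : CliqueAlgorithm n ((Fin k → F) × (Fin n → F)) (Fin n → F)}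
    (hA : MultipliesWithin F n k T A) : 1 ≤ T := by
  rcases T with _ | T
  · exfalso
    have hn0 : 0 < n := by omega
    have key : ∀ a : F, ∃ y : Fin n → F,
        A.output (A.init ⟨0, hn0⟩ (fun _ => 1, fun _ => 0)) = some y ∧ y ⟨1, hn⟩ = a := by
      intro a
      obtain ⟨y, hy, hmul⟩ := hA (Matrix.of fun _ i => if i = ⟨0, hn0⟩ then 1 else 0)
        (Matrix.of fun _ j => if j = ⟨0, hn0⟩ then 0 else a)
      refine ⟨y ⟨0, hn0⟩, by simpa [CliqueAlgorithm.stateAfter] using hy ⟨0, hn0⟩, ?_⟩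
      rw [hmul ⟨0, hn0⟩ hk]
      simp [Matrix.mul_apply]
    obtain ⟨y, h1, h2⟩ := key 0
    obtain ⟨y', h1', h2'⟩ := key 1
    obtain rfl : y = y' := Option.some.inj (h1.symm.trans h1')
    exact zero_ne_one (h2.symm.trans h2')
  · omega

/-- The trial with the sampled start vertices and the colours given by `ω` finds a cycle through
one of the first `k` start vertices. -/
def TrialSucceeds (F : Type) [Field F] (G : Digraph (Fin n)) (k : ℕ)
    (ω : Fin n → Fin n × Fin (h + 1)) : Prop :=
  ∃ r : Fin n, r.val < k ∧
    walkSum (G.adjacency F) (fun v => (ω v).2) (ω r).1 h (ω r).1 ≠ 0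

theorem TrialSucceeds.hasCycle {G : Digraph (Fin n)} {ω : Fin n → Fin n × Fin (h + 1)}
    (hω : TrialSucceeds F G k ω) : G.HasCycle h := by
  obtain ⟨r, -, hr⟩ := hω
  exact hasCycle_of_walkSum_ne_zero G _ _ hr

theorem roundComputable_trial [Fintype F] (hn : 2 ≤ n) (hF : Fintype.card F ≤ n ^ q)
    (hk : k ≤ n) {A : CliqueAlgorithm n ((Fin k → F) × (Fin n → F)) (Fin n → F)}
    (hA : MultipliesWithin F n k T A) {σ : Type} (col : σ → Fin n → F)
    (coin : σ → Fin n × Fin (h + 1)) :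
    ∃ b : (Fin n → σ) → Fin n → Prop, RoundComputable (2 + h * (T + q)) b ∧
      ∀ (G : Digraph (Fin n)) (x : Fin n → σ), (∀ v u, col (x v) u = G.adjacency F u v) →
        ((∃ v, b x v) ↔ TrialSucceeds F G k fun v => coin (x v)) := by
  refine ⟨_, (roundComputable_closed_walk (h := h) hn hF hk hA).comp_local
    fun _ a => (col a, coin a), fun G x hx => ?_⟩
  have e : (fun u w => col (x w) u) = G.adjacency F := by
    funext u w
    exact hx w u
  simp only [e]
  constructor
  · rintro ⟨v, r, hr, rfl, h1⟩
    exact ⟨r, hr, h1⟩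
  · rintro ⟨r, hr, h1⟩
    exact ⟨_, r, hr, rfl, h1⟩

open Classical in
/-- The detection algorithm, when every vertex is given `L` start vertices and colours. -/
theorem exists_detection_algorithm [Fintype F] (hn : 2 ≤ n) (hF : Fintype.card F ≤ n ^ q)
    (h L : ℕ) :
    ∃ A : CliqueAlgorithm n (Set (Fin n) × (Fin L → Fin n × Fin (h + 1))) Bool,
      ∀ (G : Digraph (Fin n)) (ω : Fin n → Fin L → Fin n × Fin (h + 1)), ∃ T ans,
        A.HaltsAt (fun v => ({u | G.Adj v u}, ω v)) T (fun _ => ans) ∧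
        (ans = true → G.HasCycle h) ∧
        ∀ k, 1 ≤ k → k ≤ n →
          (k = n ∨ ∃ ℓ, TrialSucceeds F G (2 ^ Nat.log 2 k) fun v => ω v ℓ) →
          ((∃ ℓ, TrialSucceeds F G (2 ^ Nat.log 2 k) fun v => ω v ℓ) → ans = true) ∧
          ∀ T' A', MultipliesWithin F n k T' A' →
            T ≤ 1 + (Nat.log 2 k + 1) * L * (3 + h * (T' + q)) := by
  choose t M hM ht using fun j => exists_optimal_multipliesWithin F hn (2 ^ j)
  let σ := (Fin n → F) × (Fin L → Fin n × Fin (h + 1))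
  have hb : ∀ i : ℕ × Fin L, ∃ b : (Fin n → σ) → Fin n → Prop,
      2 ^ i.1 ≤ n → (RoundComputable (2 + h * (t i.1 + q)) b ∧
        ∀ (G : Digraph (Fin n)) (x : Fin n → σ), (∀ v u, (x v).1 u = G.adjacency F u v) →
          ((∃ v, b x v) ↔ TrialSucceeds F G (2 ^ i.1) fun v => (x v).2 i.2)) := by
    intro i
    by_cases hi : 2 ^ i.1 ≤ n
    · obtain ⟨b, hb⟩ := roundComputable_trial hn hF hi (hM i.1) (σ := σ) (fun a => a.1)
        (fun a => a.2 i.2)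
      exact ⟨b, fun _ => hb⟩
    -- A dummy test: widths above `n` are never used.
    · exact ⟨fun _ _ => True, fun h => absurd h hi⟩
  choose b hb using hb
  let l (J : ℕ) : List (ℕ × Fin L) := (List.range J).flatMap fun j => (List.finRange L).map (j, ·)
  have hl : ∀ J i, i ∈ l J ↔ i.1 < J := by
    rintro J ⟨j, ℓ⟩
    simp [l]
  have hpow : ∀ j, j < Nat.log 2 n + 1 → 2 ^ j ≤ n := fun j hj =>
    (Nat.le_log_iff_pow_le (by norm_num) (by omega)).1 (by omega)
  -- All widths up to `2 ^ Nat.log 2 k` are at most `k`, so an algorithm for `k` bounds each of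
  -- their optimal costs. The `3` is the `2` of a trial plus the vote.
  have hsum : ∀ k T' A', 1 ≤ k → MultipliesWithin F n k T' A' →
      ((l (Nat.log 2 k + 1)).map fun i => 2 + h * (t i.1 + q) + 1).sum
        ≤ (Nat.log 2 k + 1) * L * (3 + h * (T' + q)) := by
    intro k T' A' hk hA'
    refine (List.sum_le_card_nsmul _ (3 + h * (T' + q)) ?_).trans_eq ?_
    · simp only [List.mem_map, forall_exists_index, and_imp]
      rintro _ i hi rfl
      have h1 : 2 ^ i.1 ≤ k := (Nat.le_log_iff_pow_le (by norm_num) (by omega)).1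
        (Nat.lt_succ_iff.1 ((hl _ _).1 hi))
      have h2 := Nat.mul_le_mul_left h (Nat.add_le_add_right (ht i.1 k T' A' h1 hA') q)
      omega
    · simp [l, List.length_flatMap]
  obtain ⟨A, hA⟩ := RoundComputable.exists_search hn (fun i => 2 + h * (t i.1 + q)) b
    (l (Nat.log 2 n + 1)) fun i hi => (hb i (hpow _ ((hl _ _).1 hi))).1
  -- Vertices know their out-neighbours, a row of the adjacency matrix; one round provides the
  -- column.
  obtain ⟨A', hA'⟩ := (((RoundComputable.exchange (n := n) (α := Prop) (R := 1) (by simpa using hn)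
      (fun _ (a : Set (Fin n) × (Fin L → Fin n × Fin (h + 1))) v => v ∈ a.1)).with_input).map
      (fun _ a => ((fun u => if a.2 u then (1 : F) else 0, a.1.2) : σ))).prepend A
  refine ⟨A', fun G ω => ?_⟩
  let x : Fin n → σ := fun v => (fun u => if v ∈ {w | G.Adj u w} then 1 else 0, ω v)
  have hx : ∀ v u, (x v).1 u = G.adjacency F u v := fun v u => by
    simp only [x, Digraph.adjacency]
    congr
  obtain ⟨T, ans, h1, h2, h3, h4⟩ := hA x
  refine ⟨1 + T, ans, hA' _ _ _ h1, fun hans => ?_, fun k hk hkn hs => ?_⟩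
  · obtain ⟨i, hi, hv⟩ := h2 hans
    exact (((hb i (hpow _ ((hl _ _).1 hi))).2 G x hx).1 hv).hasCycle
  · have hlog : Nat.log 2 k ≤ Nat.log 2 n := Nat.log_mono_right hkn
    have hfound : (∃ ℓ, TrialSucceeds F G (2 ^ Nat.log 2 k) fun v => ω v ℓ) → ans = true ∧
        T ≤ ((l (Nat.log 2 k + 1)).map fun i => 2 + h * (t i.1 + q) + 1).sum := by
      rintro ⟨ℓ, hℓ⟩
      -- Split the list after the width `2 ^ Nat.log 2 k`: an alarm in this prefix stops the search
      -- within the cost of the prefix.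
      obtain ⟨d, hd⟩ := Nat.exists_eq_add_of_le (Nat.succ_le_succ hlog)
      refine h4 (l (Nat.log 2 k + 1)) (((List.range d).map (Nat.log 2 k + 1 + ·)).flatMap
        fun j => (List.finRange L).map (j, ·)) ?_ ⟨(Nat.log 2 k, ℓ), (hl _ _).2 (by simp), ?_⟩
      · change (List.range (Nat.log 2 n).succ).flatMap _ = _
        rw [hd, List.range_add, List.flatMap_append]
      · exact ((hb _ (hpow _ (Nat.lt_succ_of_le hlog))).2 G x hx).2 hℓ
    refine ⟨fun hℓ => (hfound hℓ).1, fun T' M' hM' => Nat.add_le_add_left ?_ 1⟩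
    rcases hs with rfl | hs
    · exact h3.trans (hsum _ _ _ hk hM')
    · exact (hfound hs).2.trans (hsum _ _ _ hk hM')

end Multiplication

/-! ### Success probabilities under the uniform distribution -/

section Probability

variable {Ω Ω' : Type} [Fintype Ω] [Fintype Ω']

theorem uniformProb_mono {P Q : Ω → Prop} (hPQ : ∀ ω, P ω → Q ω) :
    uniformProb P ≤ uniformProb Q := by
  unfold uniformProb
  gcongr
  exact_mod_cast Nat.card_le_card_of_injective (Subtype.map id hPQ)
    (Subtype.map_injective hPQ Function.injective_id)

theorem uniformProb_comp_equiv (e : Ω' ≃ Ω) (P : Ω → Prop) :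
    uniformProb (fun ω => P (e ω)) = uniformProb P := by
  unfold uniformProb
  rw [Fintype.card_congr e, Nat.card_congr (e.subtypeEquiv fun _ => Iff.rfl)]

theorem uniformProb_of_forall [Nonempty Ω] {P : Ω → Prop} (hP : ∀ ω, P ω) :
    uniformProb P = 1 := by
  unfold uniformProb
  rw [Nat.card_congr (Equiv.subtypeUnivEquiv hP), Nat.card_eq_fintype_card]
  exact div_self (by exact_mod_cast Fintype.card_ne_zero)

theorem mul_card_le_of_le_uniformProb [Nonempty Ω] {P : Ω → Prop} {a : ℝ}
    (ha : a ≤ uniformProb P) : a * Fintype.card Ω ≤ Nat.card {ω // P ω} := by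
  have h0 : (0 : ℝ) < Fintype.card Ω := by exact_mod_cast Fintype.card_pos
  exact (le_div_iff₀ h0).1 ha

/-- Count fibrewise: every `s` satisfying `P` contributes at least a fraction `b` of its fibre. -/
theorem mul_le_uniformProb_prod [Nonempty Ω] [Nonempty Ω'] {P : Ω → Prop} {Q : Ω × Ω' → Prop}
    {a b : ℝ} (hb : 0 ≤ b) (hP : a ≤ uniformProb P)
    (hQ : ∀ s, P s → b ≤ uniformProb fun c => Q (s, c)) : a * b ≤ uniformProb Q := by
  classical
  have h0 : (0 : ℝ) < Fintype.card (Ω × Ω') := by exact_mod_cast Fintype.card_pos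
  refine (le_div_iff₀ h0).2 ?_
  have h1 : Nat.card {p // Q p} = ∑ s, Nat.card {c // Q (s, c)} := by
    rw [← Nat.card_sigma]
    exact Nat.card_congr
      { toFun := fun p => ⟨p.1.1, p.1.2, p.2⟩
        invFun := fun p => ⟨(p.1, p.2.1), p.2.2⟩
        left_inv := fun _ => rfl
        right_inv := fun _ => rfl }
  have h2 : ∀ s, (if P s then b * Fintype.card Ω' else 0) ≤ (Nat.card {c // Q (s, c)} : ℝ) := by
    intro s
    split_ifs with hs
    · exact mul_card_le_of_le_uniformProb (hQ s hs)
    · positivity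
  have h3 : (Nat.card {s // P s} : ℝ) * (b * Fintype.card Ω')
      = ∑ s, if P s then b * Fintype.card Ω' else 0 := by
    rw [← Finset.sum_filter, Finset.sum_const, nsmul_eq_mul, Nat.card_eq_fintype_card,
      Fintype.card_subtype]
  calc a * b * (Fintype.card (Ω × Ω') : ℝ)
      = a * Fintype.card Ω * (b * Fintype.card Ω') := by
        rw [Fintype.card_prod]
        push_cast
        ring
    _ ≤ Nat.card {s // P s} * (b * Fintype.card Ω') := by
        gcongr
        exact mul_card_le_of_le_uniformProb hP
    _ ≤ _ := by
        rw [h3, h1]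
        push_cast
        exact Finset.sum_le_sum fun s _ => h2 s

/-- Independent repetitions of an experiment. -/
theorem one_sub_exp_le_uniformProb_exists {ι : Type} [Fintype ι] [DecidableEq ι] [Nonempty Ω]
    {P : Ω → Prop} {p : ℝ} (hP : p ≤ uniformProb P) (I : Finset ι) :
    1 - Real.exp (-(p * I.card)) ≤ uniformProb fun f : ι → Ω => ∃ i ∈ I, P (f i) := by
  classical
  have h0 : (0 : ℝ) < Fintype.card Ω := by exact_mod_cast Fintype.card_pos
  have h1 : (0 : ℝ) < Fintype.card (ι → Ω) := by exact_mod_cast Fintype.card_pos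
  have h2 : Nat.card {f : ι → Ω // ∃ i ∈ I, P (f i)}
      + Nat.card {f : ι → Ω // ¬ ∃ i ∈ I, P (f i)} = Fintype.card (ι → Ω) := by
    rw [Nat.card_eq_fintype_card, Nat.card_eq_fintype_card, Fintype.card_subtype_compl]
    have := Fintype.card_subtype_le fun f : ι → Ω => ∃ i ∈ I, P (f i)
    omega
  -- The failing families form a box, restricted in the coordinates from `I` only.
  have h3 : Nat.card {f : ι → Ω // ¬ ∃ i ∈ I, P (f i)} = ∏ i,
      (if i ∈ I then ({a | ¬ P a} : Finset Ω) else Finset.univ).card := by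
    rw [← Fintype.card_piFinset, Nat.card_eq_fintype_card, Fintype.card_subtype]
    congr 1
    ext f
    simp only [not_exists, not_and, Finset.mem_filter, Finset.mem_univ, true_and,
      Fintype.mem_piFinset]
    refine forall_congr' fun i => ?_
    split_ifs with hi <;> simp [hi]
  have h4 : ((({a | ¬ P a} : Finset Ω).card : ℕ) : ℝ) ≤ (1 - p) * Fintype.card Ω := by
    have h5 := mul_card_le_of_le_uniformProb hP
    rw [Nat.card_eq_fintype_card, Fintype.card_subtype] at h5
    have h6 : (({a | P a} : Finset Ω).card : ℝ) + (({a | ¬ P a} : Finset Ω).card : ℝ)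
        = Fintype.card Ω := by
      exact_mod_cast Finset.card_filter_add_card_filter_not (s := Finset.univ) P
    linarith
  have h7 : (Nat.card {f : ι → Ω // ¬ ∃ i ∈ I, P (f i)} : ℝ)
      ≤ Real.exp (-(p * I.card)) * Fintype.card (ι → Ω) := by
    calc (Nat.card {f : ι → Ω // ¬ ∃ i ∈ I, P (f i)} : ℝ)
        ≤ ∏ i : ι, (Real.exp (if i ∈ I then -p else 0) * Fintype.card Ω) := by
          rw [h3]
          push_cast
          refine Finset.prod_le_prod (fun _ _ => by positivity) fun i _ => ?_
          split_ifs with hi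
          · refine h4.trans ?_
            gcongr
            exact Real.one_sub_le_exp_neg p
          · simp
      _ = _ := by
          rw [Finset.prod_mul_distrib, ← Real.exp_sum, Finset.sum_ite_mem, Finset.univ_inter,
            Finset.sum_const, Finset.prod_const, Fintype.card_fun, Finset.card_univ, nsmul_eq_mul]
          push_cast
          ring_nf
  refine (le_div_iff₀ h1).2 ?_
  have h8 : (Nat.card {f : ι → Ω // ∃ i ∈ I, P (f i)} : ℝ)
      + Nat.card {f : ι → Ω // ¬ ∃ i ∈ I, P (f i)} = Fintype.card (ι → Ω) := by
    exact_mod_cast h2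
  linarith

theorem inv_le_uniformProb_colouring {V F : Type} [Fintype V] [DecidableEq V] [Field F]
    {G : Digraph V} {h : ℕ} {c : Fin h → V} (hc : G.IsCycleTuple h c) {s : V}
    (hs : s ∈ Set.range c) :
    (1 : ℝ) / (h + 1) ^ h ≤ uniformProb fun col : V → Fin (h + 1) =>
      walkSum (G.adjacency F) (fun v => col v) s h s ≠ 0 := by
  obtain ⟨i₀, rfl⟩ := hs
  have h1 := card_colourings_le (F := F) hc i₀
  have h2 : (0 : ℝ) < Fintype.card (V → Fin (h + 1)) := by exact_mod_cast Fintype.card_pos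
  unfold uniformProb
  rw [div_le_div_iff₀ (by positivity) h2, one_mul, ← Nat.card_eq_fintype_card]
  exact_mod_cast h1

/-- The success probability of a trial with sufficiently many start vertices. -/
theorem inv_le_uniformProb_trialSucceeds {F : Type} [Field F] {n k h : ℕ} (hn : 0 < n)
    (G : Digraph (Fin n)) (hk : k ≤ n) (hkx : n ≤ 2 * k * (G.cycleVertices h).ncard) :
    (1 : ℝ) / (3 * (h + 1) ^ h) ≤ uniformProb (TrialSucceeds (h := h) F G k) := by
  have : Nonempty (Fin n) := ⟨⟨0, hn⟩⟩
  let X := G.cycleVertices h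
  have hX : (X.ncard : ℝ) / n ≤ uniformProb fun v => v ∈ X := by
    unfold uniformProb
    rw [Fintype.card_fin]
    rfl
  have h1 := one_sub_exp_le_uniformProb_exists hX ({r | r.val < k} : Finset (Fin n))
  have h2 : ({r | r.val < k} : Finset (Fin n)).card = k := by
    rw [Fin.card_filter_val_lt, min_eq_right hk]
  have h3 : Real.exp (-((X.ncard : ℝ) / n * k)) ≤ 2 / 3 := by
    have hn' : (0 : ℝ) < n := by exact_mod_cast hn
    have h4 : (1 : ℝ) / 2 ≤ (X.ncard : ℝ) / n * k := by
      rw [div_mul_eq_mul_div, div_le_div_iff₀ (by norm_num) hn']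
      have : (n : ℝ) ≤ 2 * k * X.ncard := by exact_mod_cast hkx
      linarith
    -- From `1 + 1/2 ≤ exp (1/2)`.
    rw [Real.exp_neg, inv_le_comm₀ (Real.exp_pos _) (by norm_num)]
    have := Real.add_one_le_exp ((X.ncard : ℝ) / n * k)
    linarith
  rw [h2] at h1
  have h5 : (1 : ℝ) / 3 ≤ uniformProb fun s : Fin n → Fin n =>
      ∃ r ∈ ({r | r.val < k} : Finset (Fin n)), s r ∈ X := by linarith
  -- Fix start vertices that hit a cycle; the colours are independent of them.
  have h6 := mul_le_uniformProb_prod (Ω' := Fin n → Fin (h + 1))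
    (Q := fun p : (Fin n → Fin n) × (Fin n → Fin (h + 1)) => TrialSucceeds (h := h) F G k fun v => (p.1 v, p.2 v))
    (b := 1 / (h + 1) ^ h) (by positivity) h5 fun s hs => by
      obtain ⟨r, hr, c, hc, hrc⟩ := hs
      refine (inv_le_uniformProb_colouring (F := F) hc hrc).trans (uniformProb_mono fun col hcol => ?_)
      exact ⟨r, by simpa using hr, hcol⟩
  have h7 := uniformProb_comp_equiv
    (Equiv.arrowProdEquivProdArrow (Fin n) (fun _ => Fin n) (fun _ => Fin (h + 1))).symm
    (TrialSucceeds (h := h) F G k)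
  rw [← h7]
  refine le_trans (le_of_eq ?_) h6
  rw [div_mul_div_comm, one_mul]

end Probability

/-! ### Choice of parameters and the main theorem -/

theorem ceil_div_bounds {n x : ℕ} (hn : 2 ≤ n) (hx : 1 ≤ x) :
    1 ≤ ⌈(n : ℚ) / (x : ℚ)⌉₊ ∧ ⌈(n : ℚ) / (x : ℚ)⌉₊ ≤ n ∧
      n ≤ 2 * 2 ^ Nat.log 2 ⌈(n : ℚ) / (x : ℚ)⌉₊ * x := by
  have hx0 : (0 : ℚ) < x := by exact_mod_cast hx
  have hn0 : (0 : ℚ) < n := by exact_mod_cast (by omega : 0 < n)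
  refine ⟨Nat.one_le_iff_ne_zero.2 (Nat.ceil_pos.2 (by positivity)).ne', ?_, ?_⟩
  · refine Nat.ceil_le.2 (div_le_self hn0.le ?_)
    exact_mod_cast hx
  · have h1 := Nat.le_ceil ((n : ℚ) / (x : ℚ))
    rw [div_le_iff₀ hx0] at h1
    have h2 : n ≤ ⌈(n : ℚ) / (x : ℚ)⌉₊ * x := by exact_mod_cast h1
    -- Rounding the width down to a power of two loses less than a factor 2.
    have h3 := Nat.lt_pow_succ_log_self (b := 2) (by norm_num) ⌈(n : ℚ) / (x : ℚ)⌉₊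
    rw [pow_succ'] at h3
    exact h2.trans (Nat.mul_le_mul_right x h3.le)

theorem exp_neg_mul_clog_le {n : ℕ} (hn : 2 ≤ n) (c : ℕ) :
    Real.exp (-((c * Nat.clog 2 n : ℕ) : ℝ)) ≤ 1 / (n : ℝ) ^ c := by
  have h1 : (n : ℝ) ≤ Real.exp (Nat.clog 2 n) := by
    have h2 : (n : ℝ) ≤ 2 ^ Nat.clog 2 n := by exact_mod_cast Nat.le_pow_clog (by norm_num) n
    refine h2.trans ?_
    rw [← mul_one ((Nat.clog 2 n : ℕ) : ℝ), Real.exp_nat_mul]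
    gcongr
    have := Real.add_one_le_exp (1 : ℝ)
    linarith
  have hn0 : (0 : ℝ) < n := by exact_mod_cast (by omega : 0 < n)
  rw [Real.exp_neg, ← one_div, Nat.cast_mul, Real.exp_nat_mul]
  exact one_div_le_one_div_of_le (by positivity) (by gcongr)

theorem Digraph.hasCycle_iff_cycleVertices_ncard_pos {V : Type} [Finite V] {G : Digraph V} {h : ℕ}
    (hh : 1 ≤ h) : G.HasCycle h ↔ 1 ≤ (G.cycleVertices h).ncard := by
  rw [Nat.one_le_iff_ne_zero, ← Nat.pos_iff_ne_zero, Set.ncard_pos]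
  constructor
  · rintro ⟨c, hc⟩
    exact ⟨c ⟨0, hh⟩, c, hc, _, rfl⟩
  · rintro ⟨v, c, hc, -⟩
    exact ⟨c, hc⟩

open Classical in
theorem mainTheorem4 (h : ℕ) (hh : 1 ≤ h) (c q : ℕ) :
    ∃ C : ℕ, ∀ n : ℕ, 2 ≤ n →
      ∀ (F : Type) [Field F] [Fintype F], Fintype.card F ≤ n ^ q →
        ∃ A : RandomizedGraphAlgorithm n, ∀ G : Digraph (Fin n),
          (∀ r : Fin n → Fin A.coins, ∃ (T : ℕ) (b : Bool),
            A.AnswersWithin G r T b ∧ (b = true → G.HasCycle h)) ∧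
          ∃ T : ℕ,
            (T : ℕ∞) ≤ (C : ℕ∞) * (Nat.clog 2 n : ℕ∞) ^ 2 *
              mmRounds F n ⌈(n : ℚ) / ((max (G.cycleVertices h).ncard 1 : ℕ) : ℚ)⌉₊ ∧
            1 - 1 / (n : ℝ) ^ c ≤
              uniformProb (fun r : Fin n → Fin A.coins =>
                A.AnswersWithin G r T (decide (G.HasCycle h))) := by
  let m := 3 * (h + 1) ^ h
  -- The `1` pays for the transposing round, `2` comes from `Nat.log 2 k + 1 ≤ 2 * Nat.clog 2 n`, `m
  -- * c` from `L`, and the last factor bounds a trial with its vote per multiplication round.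
  refine ⟨1 + 2 * (m * c) * (3 + h * (1 + q)), fun n hn F _ _ hF => ?_⟩
  have hn0 : 0 < n := by omega
  have : Nonempty (Fin n) := ⟨⟨0, hn0⟩⟩
  let L := m * (c * Nat.clog 2 n)
  let Γ := Fin n × Fin (h + 1)
  obtain ⟨A, hA⟩ := exists_detection_algorithm hn hF h L
  let e : Fin (Fintype.card (Fin L → Γ)) ≃ (Fin L → Γ) := (Fintype.equivFin _).symm
  let R : RandomizedGraphAlgorithm n :=
    ⟨Fintype.card (Fin L → Γ), Fintype.card_pos, A.comap fun _ a => (a.1, e a.2)⟩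
  have hR : ∀ G r T b, A.OutputsWithin (fun v => ({u | G.Adj v u}, e (r v))) T (fun _ => b) →
      R.AnswersWithin G r T b := fun G r T b hb => (A.outputsWithin_comap _ _ _ _).2 hb
  refine ⟨R, fun G => ⟨fun r => ?_, ?_⟩⟩
  · obtain ⟨T, ans, h1, h2, -⟩ := hA G fun v => e (r v)
    exact ⟨T, ans, hR _ _ _ _ h1.2, h2⟩
  set x := (G.cycleVertices h).ncard with hx
  obtain ⟨hk1, hkn, hkx⟩ := ceil_div_bounds (x := max x 1) hn (le_max_right _ _)
  set k := ⌈(n : ℚ) / ((max x 1 : ℕ) : ℚ)⌉₊ with hk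
  obtain ⟨T', M, hM, hmin⟩ := exists_optimal_multipliesWithin F hn k
  refine ⟨1 + (Nat.log 2 k + 1) * L * (3 + h * (T' + q)), ?_, ?_⟩
  · have h1 : (T' : ℕ∞) ≤ mmRounds F n k :=
      le_iInf₂ fun T'' ⟨M', hM'⟩ => by exact_mod_cast hmin k T'' M' le_rfl hM'
    refine le_trans ?_ (mul_le_mul_right h1 _)
    have h2 : 1 ≤ T' := hM.one_le hn hk1
    have h3 : 1 ≤ Nat.clog 2 n := Nat.clog_pos (by norm_num) hn
    have h4 : Nat.log 2 k + 1 ≤ 2 * Nat.clog 2 n := by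
      have h5 := Nat.log_mono_right (b := 2) hkn
      have h6 := Nat.log_le_clog 2 n
      omega
    have h7 : 3 + h * (T' + q) ≤ (3 + h * (1 + q)) * T' := by nlinarith [Nat.zero_le (h * q)]
    have h8 : 1 ≤ Nat.clog 2 n ^ 2 * T' := Nat.mul_pos (pow_pos h3 2) h2
    have h9 : 1 + (Nat.log 2 k + 1) * L * (3 + h * (T' + q))
        ≤ (1 + 2 * (m * c) * (3 + h * (1 + q))) * Nat.clog 2 n ^ 2 * T' := by
      calc 1 + (Nat.log 2 k + 1) * L * (3 + h * (T' + q))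
          ≤ Nat.clog 2 n ^ 2 * T'
            + 2 * Nat.clog 2 n * (m * (c * Nat.clog 2 n)) * ((3 + h * (1 + q)) * T') := by
            gcongr
        _ = _ := by ring
    exact_mod_cast h9
  · by_cases hcyc : G.HasCycle h
    · have hx1 : 1 ≤ x := (Digraph.hasCycle_iff_cycleVertices_ncard_pos hh).1 hcyc
      rw [max_eq_left hx1] at hkx
      have hpk : 2 ^ Nat.log 2 k ≤ n := (Nat.pow_log_le_self 2 (by omega)).trans hkn
      have h1 := one_sub_exp_le_uniformProb_exists (ι := Fin L)
        (inv_le_uniformProb_trialSucceeds (F := F) hn0 G hpk hkx) Finset.univ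
      have h2 : (1 : ℝ) / (3 * (h + 1) ^ h) * (Finset.univ : Finset (Fin L)).card
          = ((c * Nat.clog 2 n : ℕ) : ℝ) := by
        simp only [Finset.card_univ, Fintype.card_fin, L, m]
        push_cast
        field_simp
      rw [h2] at h1
      -- Regroup the coins: private to the vertices in the model, but indexed by trials in the
      -- analysis.
      have h3 := uniformProb_comp_equiv
        (((Equiv.refl (Fin n)).arrowCongr e).trans (Equiv.piComm fun _ _ => Γ))
        (fun f : Fin L → Fin n → Γ => ∃ ℓ ∈ Finset.univ,
          TrialSucceeds F G (2 ^ Nat.log 2 k) (f ℓ))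
      rw [← h3] at h1
      refine (sub_le_sub_left (exp_neg_mul_clog_le hn c) 1).trans
        (h1.trans (uniformProb_mono fun r hr => ?_))
      obtain ⟨ℓ, -, hℓ⟩ := hr
      obtain ⟨T, ans, h4, -, h5⟩ := hA G fun v => e (r v)
      obtain ⟨h6, h7⟩ := h5 k hk1 hkn (Or.inr ⟨ℓ, hℓ⟩)
      rw [h6 ⟨ℓ, hℓ⟩] at h4
      rw [decide_eq_true hcyc]
      exact hR _ _ _ _ (h4.2.mono (h7 T' M hM))
    · have hx0 : x = 0 := by
        by_contra hx0
        exact hcyc ((Digraph.hasCycle_iff_cycleVertices_ncard_pos hh).2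
          (Nat.one_le_iff_ne_zero.2 hx0))
      -- Here no luck is needed: the search runs through all widths, and this is within the budget
      -- for `k = n`.
      have hkn' : k = n := by simp [hk, hx0]
      have : Nonempty (Fin R.coins) := ⟨⟨0, R.coins_pos⟩⟩
      rw [uniformProb_of_forall]
      · have : (0 : ℝ) ≤ 1 / (n : ℝ) ^ c := by positivity
        linarith
      intro r
      obtain ⟨T, ans, h4, h5, h6⟩ := hA G fun v => e (r v)
      have h7 : ans = false := by
        by_contra hans
        exact hcyc (h5 (by simpa using hans))
      rw [decide_eq_false hcyc, ← h7]
      exact hR _ _ _ _ (h4.2.mono ((h6 k hk1 hkn (Or.inl hkn')).2 T' M hM))
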